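/- All graphs are finite and simple. For a graph $G$, let $\mathcal{S}(G)$ be the set of real symmetric matrices $A$, with rows and columns indexed by $V(G)$, such that for all distinct $a,b\in V(G)$ the entry $A_{a,b}$ is nonzero if and only if $\{a,b\}$ is an edge of $G$ (the diagonal entries are arbitrary). For $i\in V(G)$, let $A(i)$ be the matrix obtained from $A$ by deleting row $i$ and column $i$. The matrix $A$ has the $i$-strong nullity interlacing property ($i$-SNIP) if $X=O$ is the only real symmetric matrix $X$ such that $A\circ X=O$, $I\circ X=O$ (entrywise products), and all rows of $AX$ except possibly row $i$ are zero. Define $$\xi\xi(G,i)=\max\{\operatorname{null}(A)+\operatorname{null}(A(i)) : A\in\mathcal{S}(G),\ A\text{ has }i\text{-SNIP},\ \operatorname{null}(A)\le\operatorname{null}(A(i))\}.$$ If $v$ is a vertex label occurring in both of two otherwise vertex-disjoint graphs $G$ and $H$, then the vertex sum $G\oplus_v H$ is the graph obtained from them by identifying the two vertices labeled $v$, all other vertices remaining distinct. **Theorem.** Let $G_0,G_1,G_2$ be graphs, let $v_1,v_2\in V(G_0)$ (possibly $v_1=v_2$) be labels of a vertex of $G_1$ and of a vertex of $G_2$, respectively,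 and let $G=G_1\oplus_{v_1}G_0\oplus_{v_2}G_2$, where $G_1$ and $G_2$ are connected graphs on at least $2$ vertices. Let $i\in V(G_0)$. Then $$\xi\xi(G,i)=\max\{\xi\xi(K_2\oplus_{v_1}G_0\oplus_{v_2}G_2,\,i),\ \xi\xi(G_1\oplus_{v_1}G_0\oplus_{v_2}K_2,\,i)\},$$ where in each vertex sum with the complete graph $K_2$ one of the two vertices of $K_2$ carries the label $v_1$ or $v_2$, respectively. -/

import Mathlib

namespace RootedGraph

/-- `𝒮(G)`: the real symmetric matrices indexed by the vertices of `G` whose off-diagonal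
`(a, b)`-entry is nonzero if and only if `a` and `b` are adjacent; the diagonal is arbitrary. -/
def matricesOf {V : Type*} (G : SimpleGraph V) : Set (Matrix V V ℝ) :=
  {A | A.IsSymm ∧ ∀ a b, a ≠ b → (A a b ≠ 0 ↔ G.Adj a b)}

/-- The nullity of a square real matrix. -/
noncomputable def nullity {V : Type*} [Fintype V] (A : Matrix V V ℝ) : ℕ :=
  Module.finrank ℝ (LinearMap.ker A.mulVecLin)

/-- `A(i)`: the principal submatrix obtained by removing row `i` and column `i`. -/
def deleteIndex {V : Type*} (A : Matrix V V ℝ) (i : V) : Matrix {j // j ≠ i} {j // j ≠ i} ℝ :=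
  A.submatrix Subtype.val Subtype.val

/-- `M(i,:]`: the matrix obtained by removing row `i` and keeping all columns. -/
def deleteRow {V : Type*} (M : Matrix V V ℝ) (i : V) : Matrix {j // j ≠ i} V ℝ :=
  M.submatrix Subtype.val id

/-- The `i`-strong nullity interlacing property (`i`-SNIP). -/
def HasSNIP {V : Type*} [Fintype V] [DecidableEq V] (A : Matrix V V ℝ) (i : V) : Prop :=
  ∀ X : Matrix V V ℝ, X.IsSymm → Matrix.hadamard A X = 0 →
    Matrix.hadamard (1 : Matrix V V ℝ) X = 0 → deleteRow (A * X) i = 0 → X = 0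

/-- `(G, i)` allows the nullity pair `(k, l)` with `i`-SNIP. -/
def AllowsWithSNIP {V : Type*} [Fintype V] [DecidableEq V] (G : SimpleGraph V) (i : V)
    (k l : ℕ) : Prop :=
  ∃ A ∈ matricesOf G, nullity A = k ∧ nullity (deleteIndex A i) = l ∧ HasSNIP A i

/-- The set of sums `k + l` over the nullity pairs `(k, l)` with `k ≤ l` which `(G, i)` allows
with `i`-SNIP. -/
def nullitySums {V : Type*} [Fintype V] [DecidableEq V] (G : SimpleGraph V) (i : V) : Set ℕ :=
  {s | ∃ k l, k ≤ l ∧ AllowsWithSNIP G i k l ∧ s = k + l}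

/-- The parameter `ξξ(G, i)`: the largest element of `nullitySums G i`
(see `isGreatest_xixi` for the existence of this maximum). -/
noncomputable def xixi {V : Type*} [Fintype V] [DecidableEq V] (G : SimpleGraph V) (i : V) : ℕ :=
  sSup (nullitySums G i)

theorem nullity_le_card {V : Type*} [Fintype V] (A : Matrix V V ℝ) :
    nullity A ≤ Fintype.card V := by
  have h := Submodule.finrank_le (LinearMap.ker A.mulVecLin)
  rwa [Module.finrank_fintype_fun_eq_card] at h

theorem nullity_eq_zero_of_det_ne_zero {V : Type*} [Fintype V] [DecidableEq V]
    {A : Matrix V V ℝ} (h : A.det ≠ 0) : nullity A = 0 := by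
  have hk : LinearMap.ker A.mulVecLin = ⊥ := by
    rw [LinearMap.ker_eq_bot']
    intro x hx
    exact Matrix.eq_zero_of_mulVec_eq_zero h hx
  rw [nullity, hk, finrank_bot]

theorem zero_mem_nullitySums {V : Type*} [Fintype V] [DecidableEq V] (G : SimpleGraph V)
    (i : V) : 0 ∈ nullitySums G i := by
  classical
  set c : ℝ := (Fintype.card V : ℝ) + 1 with hc
  set A : Matrix V V ℝ := Matrix.of fun a b => if a = b then c else if G.Adj a b then 1 else 0
    with hA
  have hdiag : ∀ a, A a a = c := fun a => by simp [hA]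
  have hoff : ∀ a b, a ≠ b → A a b = if G.Adj a b then 1 else 0 := fun a b hab => by
    simp [hA, hab]
  have hc0 : 0 < c := by positivity
  have hle : ∀ a b, a ≠ b → ‖A a b‖ ≤ 1 := fun a b hab => by
    rw [hoff a b hab]; split_ifs <;> simp
  have hsymm : A.IsSymm := by
    ext a b
    by_cases hab : a = b
    · subst hab; rfl
    · rw [Matrix.transpose_apply, hoff a b hab, hoff b a (Ne.symm hab)]
      simp [G.adj_comm]
  have hdet : A.det ≠ 0 := by
    apply det_ne_zero_of_sum_row_lt_diag
    intro a
    rw [hdiag, Real.norm_of_nonneg hc0.le]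
    calc ∑ b ∈ Finset.univ.erase a, ‖A a b‖ ≤ ∑ b ∈ Finset.univ.erase a, (1 : ℝ) :=
          Finset.sum_le_sum fun b hb => hle a b (Finset.ne_of_mem_erase hb).symm
      _ ≤ (Fintype.card V : ℝ) := by
          rw [Finset.sum_const, nsmul_eq_mul, mul_one]
          exact_mod_cast Finset.card_le_univ _
      _ < c := by simp [hc]
  have hdet' : (deleteIndex A i).det ≠ 0 := by
    apply det_ne_zero_of_sum_row_lt_diag
    intro a
    have h1 : deleteIndex A i a a = c := hdiag a
    rw [h1, Real.norm_of_nonneg hc0.le]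
    calc ∑ b ∈ Finset.univ.erase a, ‖deleteIndex A i a b‖
          ≤ ∑ b ∈ Finset.univ.erase a, (1 : ℝ) :=
          Finset.sum_le_sum fun b hb =>
            hle a b fun h => Finset.ne_of_mem_erase hb (Subtype.ext h.symm)
      _ ≤ (Fintype.card {j // j ≠ i} : ℝ) := by
          rw [Finset.sum_const, nsmul_eq_mul, mul_one]
          exact_mod_cast Finset.card_le_univ _
      _ ≤ (Fintype.card V : ℝ) := by exact_mod_cast Fintype.card_subtype_le _
      _ < c := by simp [hc]
  refine ⟨0, 0, le_rfl, ⟨A, ⟨hsymm, fun a b hab => ?_⟩, nullity_eq_zero_of_det_ne_zero hdet,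
    nullity_eq_zero_of_det_ne_zero hdet', ?_⟩, rfl⟩
  · rw [hoff a b hab]; simp
  · intro X hX _ hI hrow
    have hXd : ∀ a, X a a = 0 := fun a => by
      have := congrFun (congrFun hI a) a
      simpa using this
    have hAX : ∀ a, a ≠ i → ∀ b, ∑ j, A a j * X j b = 0 := fun a ha b => by
      have := congrFun (congrFun hrow ⟨a, ha⟩) b
      simpa [deleteRow, Matrix.mul_apply] using this
    have hcol : ∀ b, X i b = 0 → ∀ a, X a b = 0 := by
      intro b hib
      have hv : (fun j : {j // j ≠ i} => X j b) = 0 := by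
        apply Matrix.eq_zero_of_mulVec_eq_zero hdet'
        ext a
        have h := hAX a a.2 b
        rw [Fintype.sum_eq_add_sum_subtype_ne _ i, hib, mul_zero, zero_add] at h
        simpa [Matrix.mulVec, dotProduct, deleteIndex] using h
      intro a
      by_cases ha : a = i
      · rw [ha, hib]
      · exact congrFun hv ⟨a, ha⟩
    have hi : ∀ b, X i b = 0 := fun b => by
      rw [← hX.apply]; exact hcol i (hXd i) b
    ext a b
    exact hcol b (hi b) a

/-- The maximum in the definition of `ξξ(G, i)` exists. -/
theorem isGreatest_xixi {V : Type*} [Fintype V] [DecidableEq V] (G : SimpleGraph V) (i : V) :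
    IsGreatest (nullitySums G i) (xixi G i) := by
  have hb : BddAbove (nullitySums G i) := by
    refine ⟨Fintype.card V + Fintype.card {j // j ≠ i}, ?_⟩
    rintro s ⟨k, l, -, ⟨A, -, rfl, rfl, -⟩, rfl⟩
    exact add_le_add (nullity_le_card _) (nullity_le_card _)
  exact ⟨Nat.sSup_mem ⟨0, zero_mem_nullitySums G i⟩ hb, fun s hs => le_csSup hb hs⟩

/-- The vertex sum of `G` and `H`, identifying the vertex `v` of `G` with the vertex `w` of `H`.
The vertices of `G` are kept, as `Sum.inl`; those of `H` other than `w` are added, as `Sum.inr`;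
the identified vertex is `Sum.inl v`. -/
def vertexSum {V W : Type*} (G : SimpleGraph V) (v : V) (H : SimpleGraph W) (w : W) :
    SimpleGraph (V ⊕ {x : W // x ≠ w}) where
  Adj
    | Sum.inl a, Sum.inl b => G.Adj a b
    | Sum.inl a, Sum.inr y => a = v ∧ H.Adj w y
    | Sum.inr x, Sum.inl b => b = v ∧ H.Adj x w
    | Sum.inr x, Sum.inr y => H.Adj x y
  symm := ⟨by
    rintro (a | x) (b | y) h
    · exact SimpleGraph.Adj.symm (G := G) h
    · exact ⟨h.1, SimpleGraph.Adj.symm (G := H) h.2⟩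
    · exact ⟨h.1, SimpleGraph.Adj.symm (G := H) h.2⟩
    · exact SimpleGraph.Adj.symm (G := H) h⟩
  loopless := ⟨by
    rintro (a | x) h
    · exact G.irrefl h
    · exact H.irrefl h⟩

end RootedGraph

/-!
Suppose that the block `B` of a branch has no nonzero null vector orthogonal to the entries `b` that
connect it to its attaching vertex `v`. Then the null vectors of the whole matrix restrict to the
branch as multiples of a single vector, and the rest of the matrix sees the branch only through one
real parameter and a shift of the diagonal entry at `v`: the branch acts as a pendant edge. Every
branch with an edge at `v` realizes every value of the parameter, so such a branch can be exchanged
for any other without changing the nullities or the `i`-SNIP. Null vectors supported in two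
different branches would violate the `i`-SNIP, so at least one of the two branches of `G` is of this
kind and can be exchanged for `K₂`. Conversely, the single vertex added by `K₂` is always of this
kind.
-/

namespace RootedGraph

open Matrix

section RowKernel

variable {𝕜 m n : Type*} [CommSemiring 𝕜] [Fintype n]

/-- The vectors `z` for which `A z` vanishes outside the rows in `I`: the kernel of the matrix
obtained from `A` by deleting those rows. Taking `I` empty or a single row treats `A` and `A(i)`
uniformly. -/
def rowKernel (A : Matrix m n 𝕜) (I : Set m) : Submodule 𝕜 (n → 𝕜) :=
  (Submodule.pi Iᶜ fun _ => ⊥).comap A.mulVecLin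

theorem mem_rowKernel {A : Matrix m n 𝕜} {I : Set m} {z : n → 𝕜} :
    z ∈ rowKernel A I ↔ ∀ a ∉ I, (A *ᵥ z) a = 0 := by
  simp [rowKernel, Submodule.mem_pi]

theorem rowKernel_empty (A : Matrix m n 𝕜) : rowKernel A ∅ = LinearMap.ker A.mulVecLin := by
  ext z
  simp [mem_rowKernel, funext_iff]

theorem col_mul_mem_rowKernel {l k : Type*} [Fintype l] {A : Matrix m n 𝕜} {I : Set m}
    {Z : Matrix n l 𝕜} (hZ : ∀ y, Z.col y ∈ rowKernel A I) (Y : Matrix l k 𝕜) (x : k) :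
    (Z * Y).col x ∈ rowKernel A I := by
  rw [mem_rowKernel]
  intro a ha
  have hAZ (y) : (A * Z) a y = 0 := mem_rowKernel.1 (hZ y) a ha
  change (A * (Z * Y)) a x = 0
  rw [← Matrix.mul_assoc, Matrix.mul_apply]
  exact Finset.sum_eq_zero fun y _ => by rw [hAZ, zero_mul]

/-- No nonzero vector in the kernel of `A` is supported in `S`; equivalently, the columns of `A`
indexed by `S` are linearly independent. -/
def TrivialKernelOn (A : Matrix m n 𝕜) (S : Set n) : Prop :=
  ∀ z, A *ᵥ z = 0 → Function.support z ⊆ S → z = 0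

theorem TrivialKernelOn.submatrix {m' n' : Type*} [Fintype n'] {A : Matrix m n 𝕜} {S : Set n}
    (h : TrivialKernelOn A S) (f : m' ≃ m) (e : n' ≃ n) :
    TrivialKernelOn (A.submatrix f e) (e ⁻¹' S) := by
  intro z hz hzS
  have hz' : z ∘ e.symm = 0 := by
    refine h _ ?_ fun a ha => by simpa using hzS ha
    rw [submatrix_mulVec_equiv] at hz
    exact f.surjective.injective_comp_right hz
  exact e.symm.surjective.injective_comp_right hz'

end RowKernel

section Nullity

variable {V W : Type*} [Fintype V] [Fintype W]

theorem nullity_add_rank (A : Matrix V V ℝ) : nullity A + A.rank = Fintype.card V := by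
  rw [add_comm, nullity, Matrix.rank, LinearMap.finrank_range_add_finrank_ker,
    Module.finrank_fintype_fun_eq_card]

theorem nullity_submatrix (A : Matrix V V ℝ) (e : W ≃ V) :
    nullity (A.submatrix e e) = nullity A := by
  have hA := nullity_add_rank A
  have hAe := nullity_add_rank (A.submatrix e e)
  rw [rank_submatrix, Fintype.card_congr e] at hAe
  omega

variable [DecidableEq V] [DecidableEq W]

theorem nullity_deleteIndex_submatrix (A : Matrix V V ℝ) (e : W ≃ V) (i : W) :
    nullity (deleteIndex (A.submatrix e e) i) = nullity (deleteIndex A (e i)) :=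
  nullity_submatrix (deleteIndex A (e i)) (e.subtypeEquiv fun _ => e.injective.ne_iff.symm)

theorem rowKernel_inf_ker_proj_eq_map (A : Matrix V V ℝ) (i : V) :
    rowKernel A {i} ⊓ LinearMap.ker (LinearMap.proj i) =
      (LinearMap.ker (deleteIndex A i).mulVecLin).map
        (Function.ExtendByZero.linearMap ℝ (Subtype.val : {j // j ≠ i} → V)) := by
  have mulVec_restrict (z : V → ℝ) (hz : z i = 0) (a : {j // j ≠ i}) :
      (deleteIndex A i *ᵥ (z ∘ Subtype.val)) a = (A *ᵥ z) a := by
    simp [mulVec, dotProduct, deleteIndex, Fintype.sum_eq_add_sum_subtype_ne _ i, hz]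
  ext z
  rw [Submodule.mem_inf, mem_rowKernel, LinearMap.mem_ker, LinearMap.proj_apply,
    Submodule.mem_map]
  constructor
  · rintro ⟨hAz, hzi⟩
    refine ⟨z ∘ Subtype.val, funext fun a => (mulVec_restrict z hzi a).trans (hAz a a.2), ?_⟩
    ext a
    by_cases ha : a = i
    · subst ha
      rw [hzi]
      exact Function.extend_apply' _ _ _ fun ⟨j, hj⟩ => j.2 hj
    · exact Subtype.val_injective.extend_apply (z ∘ Subtype.val) 0 ⟨a, ha⟩
  · rintro ⟨y, hy, rfl⟩
    have hi : Function.ExtendByZero.linearMap ℝ Subtype.val y i = 0 :=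
      Function.extend_apply' _ _ _ fun ⟨j, hj⟩ => j.2 hj
    have hy' : Function.ExtendByZero.linearMap ℝ Subtype.val y ∘ Subtype.val = y :=
      Function.extend_comp Subtype.val_injective y 0
    refine ⟨fun a ha => ?_, hi⟩
    rw [← mulVec_restrict _ hi ⟨a, ha⟩, hy']
    exact congrFun hy ⟨a, ha⟩

theorem nullity_deleteIndex (A : Matrix V V ℝ) (i : V) :
    nullity (deleteIndex A i) =
      Module.finrank ℝ ↥(rowKernel A {i} ⊓ LinearMap.ker (LinearMap.proj i)) := by
  rw [rowKernel_inf_ker_proj_eq_map, nullity]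
  exact (Submodule.equivMapOfInjective _
    (Function.extend_injective Subtype.val_injective fun _ => 0) _).finrank_eq

end Nullity

section SNIP

variable {V W : Type*} [Fintype V] [DecidableEq V] [Fintype W] [DecidableEq W]

theorem hasSNIP_iff (A : Matrix V V ℝ) (i : V) :
    HasSNIP A i ↔ ∀ X : Matrix V V ℝ, X.IsSymm → (∀ a b, A a b * X a b = 0) →
      (∀ a, X a a = 0) → (∀ b, X.col b ∈ rowKernel A {i}) → X = 0 := by
  refine forall_congr' fun X => forall_congr' fun _ => ?_
  have hadamard_A : hadamard A X = 0 ↔ ∀ a b, A a b * X a b = 0 := by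
    simp [← Matrix.ext_iff]
  have hadamard_one : hadamard (1 : Matrix V V ℝ) X = 0 ↔ ∀ a, X a a = 0 := by
    simp [← Matrix.ext_iff, one_apply]
  have columns : deleteRow (A * X) i = 0 ↔ ∀ b, X.col b ∈ rowKernel A {i} := by
    rw [forall_congr' fun b => mem_rowKernel, ← Matrix.ext_iff, forall_comm]
    simp [deleteRow, Matrix.mul_apply, mulVec, dotProduct]
  rw [hadamard_A, hadamard_one, columns]

theorem HasSNIP.submatrix {A : Matrix V V ℝ} (e : W ≃ V) {i : W} (hA : HasSNIP A (e i)) :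
    HasSNIP (A.submatrix e e) i := by
  rw [hasSNIP_iff] at hA ⊢
  intro X hX hAX hdiag hcol
  have hX' : X.submatrix e.symm e.symm = 0 := by
    refine hA _ (hX.submatrix _) (fun a b => ?_) (fun a => hdiag _) (fun b => ?_)
    · simpa using hAX (e.symm a) (e.symm b)
    · rw [mem_rowKernel]
      intro a ha
      have h := mem_rowKernel.1 (hcol (e.symm b)) (e.symm a) (by simpa [e.symm_apply_eq] using ha)
      rw [submatrix_mulVec_equiv, Function.comp_apply, e.apply_symm_apply] at h
      exact h
  ext a b
  simpa using congrFun₂ hX' (e a) (e b)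

/-- Null vectors `x` and `y` supported in `S` and `T` give the test matrix `x yᵀ + y xᵀ`. -/
theorem HasSNIP.trivialKernelOn_or {A : Matrix V V ℝ} {i : V} (hA : HasSNIP A i)
    (hsymm : A.IsSymm) {S T : Set V} (hST : Disjoint S T) (h0 : ∀ a ∈ S, ∀ b ∈ T, A a b = 0) :
    TrivialKernelOn A S ∨ TrivialKernelOn A T := by
  by_contra! h
  simp only [TrivialKernelOn, not_forall] at h
  obtain ⟨⟨x, hx, hxS, hx0⟩, y, hy, hyT, hy0⟩ := h
  have disjoint (a) : x a * y a = 0 := by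
    by_contra h
    exact hST.notMem_of_mem_left (hxS (left_ne_zero_of_mul h)) (hyT (right_ne_zero_of_mul h))
  have separated (a b) : A a b * (x a * y b) = 0 := by
    by_contra h
    have hxy := right_ne_zero_of_mul h
    exact left_ne_zero_of_mul h
      (h0 a (hxS (left_ne_zero_of_mul hxy)) b (hyT (right_ne_zero_of_mul hxy)))
  have hX : vecMulVec x y + vecMulVec y x = 0 := by
    refine (hasSNIP_iff A i).1 hA _ ?_ (fun a b => ?_) (fun a => ?_) (fun b => ?_)
    · rw [IsSymm, transpose_add, transpose_vecMulVec, transpose_vecMulVec, add_comm]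
    · rw [Matrix.add_apply, vecMulVec_apply, vecMulVec_apply, mul_add, separated, ← hsymm.apply,
        mul_comm (y a), separated, add_zero]
    · rw [Matrix.add_apply, vecMulVec_apply, vecMulVec_apply, mul_comm (y a), disjoint, add_zero]
    · have hcol : (vecMulVec x y + vecMulVec y x).col b = y b • x + x b • y := by
        ext a
        simp [vecMulVec_apply, mul_comm]
      rw [mem_rowKernel, hcol, mulVec_add, mulVec_smul, mulVec_smul, hx, hy]
      simp
  obtain ⟨a, ha⟩ := Function.ne_iff.1 hx0
  obtain ⟨b, hb⟩ := Function.ne_iff.1 hy0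
  have hya : y a = 0 := (mul_eq_zero.1 (disjoint a)).resolve_left ha
  have hab := congrFun₂ hX a b
  rw [Matrix.add_apply, vecMulVec_apply, vecMulVec_apply, hya, zero_mul, add_zero] at hab
  exact mul_ne_zero ha hb hab

end SNIP

section MatricesOf

variable {V W : Type*}

theorem submatrix_mem_matricesOf {G : SimpleGraph V} {H : SimpleGraph W} {A : Matrix V V ℝ}
    (hA : A ∈ matricesOf G) (f : H ↪g G) : A.submatrix f f ∈ matricesOf H :=
  ⟨hA.1.submatrix f, fun _ _ hab => (hA.2 _ _ (f.injective.ne hab)).trans f.map_adj_iff⟩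

theorem smul_mem_matricesOf {G : SimpleGraph V} {A : Matrix V V ℝ} (hA : A ∈ matricesOf G)
    {c : ℝ} (hc : c ≠ 0) : c • A ∈ matricesOf G :=
  ⟨hA.1.smul c, fun a b hab => by simp [hc, hA.2 a b hab]⟩

theorem add_single_mem_matricesOf [DecidableEq V] {G : SimpleGraph V} {A : Matrix V V ℝ}
    (hA : A ∈ matricesOf G) (v : V) (d : ℝ) : A + single v v d ∈ matricesOf G := by
  refine ⟨hA.1.add (transpose_single _ _ _), fun a b hab => ?_⟩
  have hv : ¬(v = a ∧ v = b) := fun h => hab (h.1.symm.trans h.2)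
  rw [Matrix.add_apply, single_apply_of_ne _ _ _ _ _ hv, add_zero]
  exact hA.2 a b hab

theorem exists_posDef_mem_matricesOf [Finite V] (G : SimpleGraph V) :
    ∃ A ∈ matricesOf G, A.PosDef := by
  classical
  have := Fintype.ofFinite V
  refine ⟨G.lapMatrix ℝ + 1, ⟨(G.isSymm_lapMatrix (R := ℝ)).add isSymm_one, fun a b hab => ?_⟩,
    PosDef.posSemidef_add (G.posSemidef_lapMatrix ℝ) PosDef.one⟩
  simp [SimpleGraph.lapMatrix, SimpleGraph.degMatrix, SimpleGraph.adjMatrix_apply,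
    diagonal_apply_ne _ hab, one_apply_ne hab]

end MatricesOf

section Glue

variable {𝕜 R P : Type*} [CommRing 𝕜] [DecidableEq R]

/-- The symmetric matrix of a vertex sum: `M` on the vertices of the base, `B` on those of the
branch, joined by the entries `b` between the vertex `v` of the base and the branch. -/
def glue (M : Matrix R R 𝕜) (v : R) (b : P → 𝕜) (B : Matrix P P 𝕜) : Matrix (R ⊕ P) (R ⊕ P) 𝕜 :=
  fromBlocks M (vecMulVec (Pi.single v 1) b) (vecMulVec b (Pi.single v 1)) B

/-- The matrix `glue` for a branch consisting of one vertex, joined to `v` by an entry `1` and with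
diagonal entry `-c`. -/
def gluePendant (N : Matrix R R 𝕜) (v : R) (c : 𝕜) : Matrix (R ⊕ Unit) (R ⊕ Unit) 𝕜 :=
  glue N v 1 (of fun _ _ => -c)

theorem isSymm_glue_iff {M : Matrix R R 𝕜} {v : R} {b : P → 𝕜} {B : Matrix P P 𝕜} :
    (glue M v b B).IsSymm ↔ M.IsSymm ∧ B.IsSymm := by
  rw [glue, isSymm_fromBlocks_iff, transpose_vecMulVec, transpose_vecMulVec]
  tauto

theorem forall_glue_mul_apply_eq_zero_iff {M : Matrix R R 𝕜} {v : R} {b : P → 𝕜}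
    {B : Matrix P P 𝕜} {X : Matrix (R ⊕ P) (R ⊕ P) 𝕜} :
    (∀ x y, glue M v b B x y * X x y = 0) ↔
      (∀ a a', M a a' * X (Sum.inl a) (Sum.inl a') = 0) ∧
        (∀ p, b p * X (Sum.inl v) (Sum.inr p) = 0) ∧
        (∀ p, b p * X (Sum.inr p) (Sum.inl v) = 0) ∧
        ∀ p q, B p q * X (Sum.inr p) (Sum.inr q) = 0 := by
  constructor
  · intro h
    refine ⟨fun a a' => h (Sum.inl a) (Sum.inl a'), fun p => ?_, fun p => ?_,
      fun p q => h (Sum.inr p) (Sum.inr q)⟩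
    · simpa [glue, vecMulVec_apply] using h (Sum.inl v) (Sum.inr p)
    · simpa [glue, vecMulVec_apply] using h (Sum.inr p) (Sum.inl v)
  · rintro ⟨hbase, hup, hdown, hbranch⟩ (a | p) (a' | q)
    · exact hbase a a'
    · obtain rfl | ha := eq_or_ne a v <;> simp [glue, vecMulVec_apply, *]
    · obtain rfl | ha := eq_or_ne a' v <;> simp [glue, vecMulVec_apply, *]
    · exact hbranch p q

theorem add_single_mul_apply_eq_zero_iff {M : Matrix R R 𝕜} {v : R} {d : 𝕜} {Y : Matrix R R 𝕜}
    (hY : ∀ a, Y a a = 0) (a a' : R) :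
    (M + single v v d) a a' * Y a a' = 0 ↔ M a a' * Y a a' = 0 := by
  obtain rfl | ha := eq_or_ne a a'
  · simp [hY]
  · have hv : ¬(v = a ∧ v = a') := fun h => ha (h.1.symm.trans h.2)
    rw [Matrix.add_apply, single_apply_of_ne _ _ _ _ _ hv, add_zero]

variable [Fintype R]

/-- The matrix extending kernel vectors of `gluePendant` to kernel vectors of `glue`, by `u` times
the value at the pendant vertex. -/
def branchExtend (R : Type*) [DecidableEq R] (u : P → 𝕜) : Matrix (R ⊕ P) (R ⊕ Unit) 𝕜 :=
  fromBlocks 1 0 0 (replicateCol Unit u)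

theorem branchExtend_mulVec (u : P → 𝕜) (k : R ⊕ Unit → 𝕜) :
    branchExtend R u *ᵥ k = Sum.elim (k ∘ Sum.inl) (k (Sum.inr ()) • u) := by
  rw [branchExtend, fromBlocks_mulVec]
  ext (a | p) <;> simp [mulVec, dotProduct, mul_comm]

theorem branchExtend_mul_mul_transpose (u : P → 𝕜) (X : Matrix (R ⊕ Unit) (R ⊕ Unit) 𝕜) :
    branchExtend R u * X * (branchExtend R u)ᵀ =
      of fun x y => Sum.elim (fun _ => 1) u x *
        X (x.map id fun _ => ()) (y.map id fun _ => ()) * Sum.elim (fun _ => 1) u y := by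
  ext (a | p) (b | q) <;>
    simp [branchExtend, Matrix.mul_apply, one_apply]

variable [Fintype P]

theorem glue_mulVec (M : Matrix R R 𝕜) (v : R) (b : P → 𝕜) (B : Matrix P P 𝕜) (z : R ⊕ P → 𝕜) :
    glue M v b B *ᵥ z =
      Sum.elim (M *ᵥ (z ∘ Sum.inl) + Pi.single v (b ⬝ᵥ (z ∘ Sum.inr)))
        (B *ᵥ (z ∘ Sum.inr) + z (Sum.inl v) • b) := by
  rw [glue, fromBlocks_mulVec, vecMulVec_mulVec, vecMulVec_mulVec, add_comm (B *ᵥ _)]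
  ext (a | p)
  · obtain rfl | ha := eq_or_ne a v <;> simp [*]
  · simp [mul_comm]

theorem mem_rowKernel_glue {M : Matrix R R 𝕜} {v : R} {b : P → 𝕜} {B : Matrix P P 𝕜} {I : Set R}
    {z : R ⊕ P → 𝕜} :
    z ∈ rowKernel (glue M v b B) (Sum.inl '' I) ↔
      (∀ a ∉ I, (M *ᵥ (z ∘ Sum.inl) + Pi.single v (b ⬝ᵥ (z ∘ Sum.inr)) : R → 𝕜) a = 0) ∧
        B *ᵥ (z ∘ Sum.inr) + z (Sum.inl v) • b = 0 := by
  rw [mem_rowKernel, Sum.forall, glue_mulVec]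
  refine and_congr (by simp only [Sum.inl_injective.mem_set_image, Sum.elim_inl]) ?_
  simp [funext_iff]

theorem mem_rowKernel_gluePendant {N : Matrix R R 𝕜} {v : R} {c : 𝕜} {I : Set R}
    {k : R ⊕ Unit → 𝕜} :
    k ∈ rowKernel (gluePendant N v c) (Sum.inl '' I) ↔
      (∀ a ∉ I, (N *ᵥ (k ∘ Sum.inl) + Pi.single v (k (Sum.inr ())) : R → 𝕜) a = 0) ∧
        k (Sum.inl v) = k (Sum.inr ()) * c := by
  rw [gluePendant, mem_rowKernel_glue]
  refine and_congr (by simp) ?_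
  have hpend : (of fun _ _ => -c) *ᵥ (k ∘ Sum.inr) + k (Sum.inl v) • (1 : Unit → 𝕜) =
      fun _ => k (Sum.inl v) - k (Sum.inr ()) * c := by
    ext
    simp only [Pi.add_apply, mulVec, dotProduct, Finset.univ_unique, PUnit.default_eq_unit,
      of_apply, Function.comp_apply, neg_mul, Finset.sum_neg_distrib, Finset.sum_singleton,
      Pi.smul_apply, Pi.one_apply, smul_eq_mul, mul_one]
    ring
  rw [hpend, funext_iff]
  simp only [Pi.zero_apply, forall_const, sub_eq_zero]

theorem trivialKernelOn_range_inr_glue_iff {M : Matrix R R 𝕜} {v : R} {b : P → 𝕜}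
    {B : Matrix P P 𝕜} :
    TrivialKernelOn (glue M v b B) (Set.range Sum.inr) ↔
      ∀ x, B *ᵥ x = 0 → b ⬝ᵥ x = 0 → x = 0 := by
  constructor
  · intro h x hBx hbx
    have hx : Sum.elim (0 : R → 𝕜) x = 0 := by
      refine h _ ?_ ?_
      · rw [glue_mulVec, Sum.elim_comp_inl, Sum.elim_comp_inr, hBx, hbx]
        ext (a | p) <;> simp
      · rintro (a | p) ha
        · exact absurd rfl ha
        · exact ⟨p, rfl⟩
    exact funext fun p => congrFun hx (Sum.inr p)
  · intro h z hz hsupp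
    have hz0 (a) : z (Sum.inl a) = 0 := by
      by_contra ha
      obtain ⟨p, hp⟩ := hsupp ha
      exact Sum.inr_ne_inl hp
    have hinl : z ∘ Sum.inl = 0 := funext hz0
    rw [glue_mulVec, hinl, hz0, mulVec_zero, zero_add, zero_smul, add_zero] at hz
    have hinr : z ∘ Sum.inr = 0 :=
      h _ (funext fun p => congrFun hz (Sum.inr p)) (by simpa using congrFun hz (Sum.inl v))
    ext (a | p)
    · exact hz0 a
    · exact congrFun hinr p

/-- The branch with block `B` and connecting entries `b` enters the kernel of a glued matrix only
through one parameter, as a pendant edge does: a kernel vector restricts to a multiple `t u` of `u`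
on the branch, takes the value `t c` at the attaching vertex `v`, and there the branch contributes
as much as the entry `1` of `gluePendant` together with an increase by `d` of the diagonal entry
at `v`. -/
structure ReducesToPendant (B : Matrix P P 𝕜) (b u : P → 𝕜) (c d : 𝕜) : Prop where
  mulVec_add_smul_eq_zero_iff (z : P → 𝕜) (s : 𝕜) :
    B *ᵥ z + s • b = 0 ↔ ∃ t, z = t • u ∧ s = t * c
  dotProduct_eq : b ⬝ᵥ u = 1 + d * c

variable {M : Matrix R R 𝕜} {v : R} {B : Matrix P P 𝕜} {b u : P → 𝕜} {c d : 𝕜}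

theorem ReducesToPendant.rowKernel_glue (h : ReducesToPendant B b u c d) (I : Set R) :
    rowKernel (glue M v b B) (Sum.inl '' I) =
      (rowKernel (gluePendant (M + single v v d) v c) (Sum.inl '' I)).map
        (branchExtend R u).mulVecLin := by
  have base_eq (r : R → 𝕜) (t : 𝕜) (hr : r v = t * c) :
      M *ᵥ r + Pi.single v (b ⬝ᵥ (t • u)) = (M + single v v d) *ᵥ r + Pi.single v t := by
    rw [add_mulVec, single_mulVec_eq, dotProduct_smul, h.dotProduct_eq, hr]
    ext a
    obtain rfl | ha := eq_or_ne a v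
    · simp only [smul_eq_mul, Pi.add_apply, Pi.single_eq_same, Pi.smul_apply, mul_one]
      ring
    · simp [ha]
  ext z
  simp only [mem_rowKernel_glue, Submodule.mem_map, mulVecLin_apply, mem_rowKernel_gluePendant,
    branchExtend_mulVec, h.mulVec_add_smul_eq_zero_iff]
  constructor
  · rintro ⟨hbase, t, hu, hv⟩
    refine ⟨Sum.elim (z ∘ Sum.inl) fun _ => t, ⟨?_, hv⟩, ?_⟩
    · rw [hu, base_eq _ _ hv] at hbase
      exact hbase
    · rw [Sum.elim_comp_inl, Sum.elim_inr, ← hu, Sum.elim_comp_inl_inr]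
  · rintro ⟨k, ⟨hbase, hv⟩, rfl⟩
    refine ⟨?_, k (Sum.inr ()), rfl, hv⟩
    rw [Sum.elim_comp_inl, Sum.elim_comp_inr, base_eq _ _ hv]
    exact hbase

end Glue

section BranchExtend

variable {𝕜 R P : Type*} [Field 𝕜] [DecidableEq R] [Fintype R]

theorem exists_mul_branchExtend_eq_one [Fintype P] {u : P → 𝕜} (hu : u ≠ 0) :
    ∃ L : Matrix (R ⊕ Unit) (R ⊕ P) 𝕜, L * branchExtend R u = 1 := by
  classical
  obtain ⟨p, hp⟩ := Function.ne_iff.1 hu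
  refine ⟨fromBlocks 1 0 0 (replicateRow Unit (Pi.single p (u p)⁻¹)), ?_⟩
  have hpu : replicateRow Unit (Pi.single p (u p)⁻¹) * replicateCol Unit u = 1 := by
    ext
    simp [inv_mul_cancel₀ hp]
  rw [branchExtend, fromBlocks_multiply, hpu]
  simp

theorem branchExtend_mulVecLin_injective {u : P → 𝕜} (hu : u ≠ 0) :
    Function.Injective (branchExtend R u).mulVecLin := by
  obtain ⟨p, hp⟩ := Function.ne_iff.1 hu
  intro k k' hk
  simp only [mulVecLin_apply, branchExtend_mulVec] at hk
  ext (a | _)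
  · exact congrFun hk (Sum.inl a)
  · exact mul_right_cancel₀ hp (congrFun hk (Sum.inr p))

theorem exists_eq_branchExtend_mul_mul_transpose [Finite P] {m : Type*} {A : Matrix m (R ⊕ Unit) 𝕜}
    {I : Set m} {u : P → 𝕜} (hu : u ≠ 0) {X : Matrix (R ⊕ P) (R ⊕ P) 𝕜} (hX : X.IsSymm)
    (hcol : ∀ y, X.col y ∈ (rowKernel A I).map (branchExtend R u).mulVecLin) :
    ∃ Y : Matrix (R ⊕ Unit) (R ⊕ Unit) 𝕜, Y.IsSymm ∧ (∀ y, Y.col y ∈ rowKernel A I) ∧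
      branchExtend R u * Y * (branchExtend R u)ᵀ = X := by
  have := Fintype.ofFinite P
  obtain ⟨L, hL⟩ := exists_mul_branchExtend_eq_one (R := R) hu
  choose k hk hkX using hcol
  have hLX (y) : (L * X).col y = k y := by
    change L *ᵥ X.col y = k y
    rw [← hkX y, mulVecLin_apply, mulVec_mulVec, hL, one_mulVec]
  have hELX : branchExtend R u * (L * X) = X := by
    refine ext_col fun y => ?_
    change branchExtend R u *ᵥ (L * X).col y = X.col y
    rw [hLX]
    exact hkX y
  refine ⟨L * X * Lᵀ, ?_, col_mul_mem_rowKernel (fun y => (hLX y).symm ▸ hk y) _, ?_⟩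
  · rw [IsSymm, transpose_mul, transpose_mul, transpose_transpose, hX.eq, Matrix.mul_assoc]
  · calc branchExtend R u * (L * X * Lᵀ) * (branchExtend R u)ᵀ
          = branchExtend R u * L * (branchExtend R u * (L * X))ᵀ := by
            simp only [transpose_mul, hX.eq, Matrix.mul_assoc]
      _ = X := by rw [hELX, hX.eq, Matrix.mul_assoc, hELX]

end BranchExtend

section Reduction

variable {𝕜 P : Type*} [Field 𝕜] [Fintype P] {B : Matrix P P 𝕜} {b u : P → 𝕜} {c d : 𝕜}

theorem ReducesToPendant.ne_zero (h : ReducesToPendant B b u c d) (hb : b ≠ 0) : u ≠ 0 := by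
  rintro rfl
  have hcb : B *ᵥ 0 + c • b = 0 :=
    (h.mulVec_add_smul_eq_zero_iff 0 c).2 ⟨1, by rw [smul_zero], by rw [one_mul]⟩
  rw [mulVec_zero, zero_add] at hcb
  have hc : c = 0 := (smul_eq_zero.1 hcb).resolve_right hb
  simpa [hc] using h.dotProduct_eq

theorem reducesToPendant_of_injective (hB : Function.Injective B.mulVec) (hc : c ≠ 0)
    (hu : B *ᵥ u = -(c • b)) (hd : b ⬝ᵥ u = 1 + d * c) : ReducesToPendant B b u c d := by
  refine ⟨fun z s => ⟨fun h => ⟨s / c, hB ?_, (div_mul_cancel₀ s hc).symm⟩, ?_⟩, hd⟩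
  · rw [mulVec_smul, hu, smul_neg, smul_smul, div_mul_cancel₀ s hc]
    exact eq_neg_of_add_eq_zero_left h
  · rintro ⟨t, rfl, rfl⟩
    rw [mulVec_smul, hu, smul_neg, smul_smul, neg_add_cancel]

theorem reducesToPendant_of_ker_eq_span (hB : B.IsSymm)
    (hker : LinearMap.ker B.mulVecLin = Submodule.span 𝕜 {u}) (hbu : b ⬝ᵥ u = 1) :
    ReducesToPendant B b u 0 0 := by
  have mem_ker (z : P → 𝕜) : B *ᵥ z = 0 ↔ ∃ t : 𝕜, t • u = z := by
    rw [← Submodule.mem_span_singleton, ← hker, LinearMap.mem_ker, mulVecLin_apply]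
  refine ⟨fun z s => ⟨fun h => ?_, ?_⟩, by rw [hbu, mul_zero, add_zero]⟩
  · have hu : u ᵥ* B = 0 := by
      rw [← mulVec_transpose, hB.eq]
      exact (mem_ker u).2 ⟨1, one_smul 𝕜 u⟩
    have hs : s = 0 := by
      have hus := congrArg (u ⬝ᵥ ·) h
      simpa [dotProduct_mulVec, hu, dotProduct_comm u b, hbu] using hus
    rw [hs, zero_smul, add_zero] at h
    obtain ⟨t, ht⟩ := (mem_ker z).1 h
    exact ⟨t, ht.symm, by rw [hs, mul_zero]⟩
  · rintro ⟨t, rfl, rfl⟩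
    rw [mul_zero, zero_smul, add_zero]
    exact (mem_ker _).2 ⟨t, rfl⟩

theorem exists_reducesToPendant (hB : B.IsSymm) (h : ∀ x, B *ᵥ x = 0 → b ⬝ᵥ x = 0 → x = 0) :
    ∃ (u : P → 𝕜) (c d : 𝕜), ReducesToPendant B b u c d := by
  classical
  by_cases hdet : B.det = 0
  · obtain ⟨x, hx0, hx⟩ := exists_mulVec_eq_zero_iff.2 hdet
    have hbx : b ⬝ᵥ x ≠ 0 := fun hbx => hx0 (h x hx hbx)
    refine ⟨(b ⬝ᵥ x)⁻¹ • x, 0, 0, reducesToPendant_of_ker_eq_span hB ?_ ?_⟩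
    · rw [Submodule.span_singleton_smul_eq (inv_ne_zero hbx).isUnit]
      refine le_antisymm (fun z hz => ?_) ((Submodule.span_singleton_le_iff_mem _ _).2 hx)
      refine Submodule.mem_span_singleton.2 ⟨b ⬝ᵥ z / b ⬝ᵥ x, (sub_eq_zero.1 (h _ ?_ ?_)).symm⟩
      · rw [mulVec_sub, mulVec_smul, hx, smul_zero, sub_zero]
        exact hz
      · rw [dotProduct_sub, dotProduct_smul, smul_eq_mul, div_mul_cancel₀ _ hbx, sub_self]
    · rw [dotProduct_smul, smul_eq_mul, inv_mul_cancel₀ hbx]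
  · have hunit : IsUnit B.det := isUnit_iff_ne_zero.2 hdet
    refine ⟨-(B⁻¹ *ᵥ b), 1, b ⬝ᵥ -(B⁻¹ *ᵥ b) - 1, reducesToPendant_of_injective
      (mulVec_injective_of_isUnit ((isUnit_iff_isUnit_det B).2 hunit)) one_ne_zero ?_ (by ring)⟩
    rw [mulVec_neg, mulVec_mulVec, mul_nonsing_inv _ hunit, one_mulVec, one_smul]

theorem ker_mulVecLin_add_single [DecidableEq P] (hB : Function.Injective B.mulVec) {x : P → 𝕜}
    {j : P} (hx : B *ᵥ x = Pi.single j 1) (hxj : x j ≠ 0) :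
    LinearMap.ker (B + single j j (-(x j)⁻¹)).mulVecLin = Submodule.span 𝕜 {x} := by
  ext z
  have hz : (B + single j j (-(x j)⁻¹)) *ᵥ z = B *ᵥ z - B *ᵥ ((z j / x j) • x) := by
    rw [add_mulVec, single_mulVec_eq, mulVec_smul, hx, sub_eq_add_neg, ← neg_smul]
    congr 2
    ring
  rw [LinearMap.mem_ker, mulVecLin_apply, hz, sub_eq_zero, Submodule.mem_span_singleton]
  constructor
  · exact fun h => ⟨_, (hB h).symm⟩
  · rintro ⟨t, rfl⟩
    rw [Pi.smul_apply, smul_eq_mul, mul_div_cancel_right₀ _ hxj]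

end Reduction

section Realization

variable {P : Type*} [Fintype P]

theorem exists_mem_matricesOf_reducesToPendant (G : SimpleGraph P) {b : P → ℝ} (hb : b ≠ 0)
    (c : ℝ) : ∃ B ∈ matricesOf G, ∃ u, ReducesToPendant B b u c 0 := by
  classical
  obtain ⟨B, hB, hpos⟩ := exists_posDef_mem_matricesOf G
  have hunit : IsUnit B.det := isUnit_iff_ne_zero.2 hpos.det_pos.ne'
  have hinj : Function.Injective B.mulVec :=
    mulVec_injective_of_isUnit ((isUnit_iff_isUnit_det B).2 hunit)
  have mulVec_inv (y : P → ℝ) : B *ᵥ (B⁻¹ *ᵥ y) = y := by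
    rw [mulVec_mulVec, mul_nonsing_inv _ hunit, one_mulVec]
  have dotProduct_inv_pos {y : P → ℝ} (hy : y ≠ 0) : 0 < y ⬝ᵥ (B⁻¹ *ᵥ y) := by
    simpa using hpos.inv.dotProduct_mulVec_pos hy
  have hbne := (dotProduct_inv_pos hb).ne'
  obtain rfl | hc := eq_or_ne c 0
  · obtain ⟨j, -, hj⟩ := Finset.exists_ne_zero_of_sum_ne_zero hbne
    set x : P → ℝ := B⁻¹ *ᵥ Pi.single j 1
    have hxj : x j ≠ 0 := by
      rw [← single_one_dotProduct j x]
      exact (dotProduct_inv_pos (by simp)).ne'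
    have hbx : b ⬝ᵥ x ≠ 0 := by
      rw [dotProduct_mulVec, ← mulVec_transpose, transpose_nonsing_inv, hB.1.eq,
        dotProduct_single_one]
      exact right_ne_zero_of_mul hj
    have hmem := add_single_mem_matricesOf hB j (-(x j)⁻¹)
    refine ⟨_, hmem, (b ⬝ᵥ x)⁻¹ • x, reducesToPendant_of_ker_eq_span hmem.1 ?_ ?_⟩
    · rw [Submodule.span_singleton_smul_eq (inv_ne_zero hbx).isUnit]
      exact ker_mulVecLin_add_single hinj (mulVec_inv _) hxj
    · rw [dotProduct_smul, smul_eq_mul, inv_mul_cancel₀ hbx]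
  · set q := b ⬝ᵥ (B⁻¹ *ᵥ b)
    have hcq : -(c * q) ≠ 0 := neg_ne_zero.2 (mul_ne_zero hc hbne)
    refine ⟨_, smul_mem_matricesOf hB hcq, q⁻¹ • (B⁻¹ *ᵥ b),
      reducesToPendant_of_injective ?_ hc ?_ ?_⟩
    · intro y z hyz
      simp only [smul_mulVec] at hyz
      exact hinj (smul_right_injective _ hcq hyz)
    · rw [smul_mulVec, mulVec_smul, mulVec_inv, smul_smul, ← neg_smul]
      congr 1
      field_simp
    · rw [dotProduct_smul, smul_eq_mul, inv_mul_cancel₀ hbne, zero_mul, add_zero]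

end Realization

section RealGlue

variable {R P : Type*} [Fintype R] [DecidableEq R] [Fintype P]
  {M : Matrix R R ℝ} {v : R} {B : Matrix P P ℝ} {b u : P → ℝ} {c d : ℝ}

theorem ReducesToPendant.nullity_glue (h : ReducesToPendant B b u c d) (hb : b ≠ 0) :
    nullity (glue M v b B) = nullity (gluePendant (M + single v v d) v c) := by
  have hker := h.rowKernel_glue (M := M) (v := v) ∅
  rw [Set.image_empty, Set.image_empty, rowKernel_empty, rowKernel_empty] at hker
  rw [nullity, nullity, hker]
  exact (Submodule.equivMapOfInjective _ (branchExtend_mulVecLin_injective (h.ne_zero hb))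
    _).finrank_eq.symm

variable [DecidableEq P]

theorem ReducesToPendant.nullity_deleteIndex_glue (h : ReducesToPendant B b u c d) (hb : b ≠ 0)
    (i : R) :
    nullity (deleteIndex (glue M v b B) (Sum.inl i)) =
      nullity (deleteIndex (gluePendant (M + single v v d) v c) (Sum.inl i)) := by
  have hker := h.rowKernel_glue (M := M) (v := v) {i}
  rw [Set.image_singleton, Set.image_singleton] at hker
  have hproj : (LinearMap.ker (LinearMap.proj (Sum.inl i))).comap (branchExtend R u).mulVecLin =
      LinearMap.ker (LinearMap.proj (R := ℝ) (φ := fun _ : R ⊕ Unit => ℝ) (Sum.inl i)) := by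
    ext k
    simp [branchExtend_mulVec]
  rw [nullity_deleteIndex, nullity_deleteIndex, hker, Submodule.map_inf_eq_map_inf_comap, hproj]
  exact (Submodule.equivMapOfInjective _ (branchExtend_mulVecLin_injective (h.ne_zero hb))
    _).finrank_eq.symm

theorem ReducesToPendant.hasSNIP_gluePendant (h : ReducesToPendant B b u c d) (hb : b ≠ 0) {i : R}
    (hS : HasSNIP (glue M v b B) (Sum.inl i)) :
    HasSNIP (gluePendant (M + single v v d) v c) (Sum.inl i) := by
  obtain ⟨L, hL⟩ := exists_mul_branchExtend_eq_one (R := R) (h.ne_zero hb)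
  rw [hasSNIP_iff] at hS ⊢
  intro X hX hMX hdiag hcol
  rw [gluePendant, forall_glue_mul_apply_eq_zero_iff] at hMX
  obtain ⟨hbase, hup, hdown, -⟩ := hMX
  simp only [Pi.one_apply, one_mul] at hup hdown
  have hEX : branchExtend R u * X * (branchExtend R u)ᵀ = 0 := by
    refine hS _ ?_ ?_ (fun x => ?_) (col_mul_mem_rowKernel (fun y => ?_) _)
    · rw [IsSymm, transpose_mul, transpose_mul, transpose_transpose, hX.eq, Matrix.mul_assoc]
    · rw [branchExtend_mul_mul_transpose, forall_glue_mul_apply_eq_zero_iff]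
      refine ⟨fun a a' => ?_, by simp [hup], by simp [hdown], by simp [hdiag]⟩
      simpa [toBlocks₁₁] using
        (add_single_mul_apply_eq_zero_iff (Y := X.toBlocks₁₁) (fun a => hdiag _) a a').1
          (hbase a a')
    · rw [branchExtend_mul_mul_transpose]
      obtain x | x := x <;> simp [hdiag]
    · rw [← Set.image_singleton, h.rowKernel_glue, Set.image_singleton]
      exact Submodule.mem_map_of_mem (hcol y)
  calc X = L * branchExtend R u * X * (L * branchExtend R u)ᵀ := by simp [hL]
    _ = L * (branchExtend R u * X * (branchExtend R u)ᵀ) * Lᵀ := by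
        simp only [transpose_mul, Matrix.mul_assoc]
    _ = 0 := by rw [hEX, Matrix.mul_zero, Matrix.zero_mul]

theorem ReducesToPendant.hasSNIP_glue (h : ReducesToPendant B b u c d) {p : P} (hb : b p ≠ 0)
    (hu : u p ≠ 0) {i : R} (hS : HasSNIP (gluePendant (M + single v v d) v c) (Sum.inl i)) :
    HasSNIP (glue M v b B) (Sum.inl i) := by
  rw [hasSNIP_iff] at hS ⊢
  intro X hX hMX hdiag hcol
  rw [← Set.image_singleton, h.rowKernel_glue, Set.image_singleton] at hcol
  obtain ⟨Y, hYsymm, hYcol, rfl⟩ :=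
    exists_eq_branchExtend_mul_mul_transpose (Function.ne_iff.2 ⟨p, hu⟩) hX hcol
  rw [branchExtend_mul_mul_transpose] at hMX hdiag
  obtain ⟨hbase, hup, hdown, -⟩ := forall_glue_mul_apply_eq_zero_iff.1 hMX
  have hYdiag (x) : Y x x = 0 := by
    obtain a | _ := x
    · simpa using hdiag (Sum.inl a)
    · simpa [hu] using hdiag (Sum.inr p)
  have hYup : Y (Sum.inl v) (Sum.inr ()) = 0 := by simpa [hb, hu] using hup p
  have hYdown : Y (Sum.inr ()) (Sum.inl v) = 0 := by simpa [hb, hu] using hdown p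
  have hY : Y = 0 := by
    refine hS Y hYsymm ?_ hYdiag hYcol
    rw [gluePendant, forall_glue_mul_apply_eq_zero_iff]
    refine ⟨fun a a' => ?_, by simp [hYup], by simp [hYdown], by simp [hYdiag]⟩
    refine (add_single_mul_apply_eq_zero_iff (Y := Y.toBlocks₁₁) (fun a => hYdiag _) a a').2 ?_
    simpa [toBlocks₁₁] using hbase a a'
  rw [hY, Matrix.mul_zero, Matrix.zero_mul]

end RealGlue

section VertexSum

variable {R W W' : Type*} [DecidableEq R] {H : SimpleGraph R} {v i : R} {K : SimpleGraph W} {w : W}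
  {K' : SimpleGraph W'} {w' : W'}

theorem glue_mem_matricesOf {M : Matrix R R ℝ} {b : {x // x ≠ w} → ℝ}
    {B : Matrix {x // x ≠ w} {x // x ≠ w} ℝ} (hM : M ∈ matricesOf H)
    (hb : ∀ p, b p ≠ 0 ↔ K.Adj w p) (hB : B ∈ matricesOf (K.comap Subtype.val)) :
    glue M v b B ∈ matricesOf (vertexSum H v K w) := by
  refine ⟨isSymm_glue_iff.2 ⟨hM.1, hB.1⟩, ?_⟩
  rintro (r | p) (s | q) hne
  · exact hM.2 r s (ne_of_apply_ne _ hne)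
  · simp [glue, vertexSum, vecMulVec_apply, Pi.single_apply, hb]
  · simp [glue, vertexSum, vecMulVec_apply, Pi.single_apply, hb, K.adj_comm]
  · exact hB.2 p q (ne_of_apply_ne _ hne)

theorem exists_eq_glue {A : Matrix (R ⊕ {x // x ≠ w}) (R ⊕ {x // x ≠ w}) ℝ}
    (hA : A ∈ matricesOf (vertexSum H v K w)) :
    ∃ M ∈ matricesOf H, ∃ b : {x // x ≠ w} → ℝ, (∀ p, b p ≠ 0 ↔ K.Adj w p) ∧
      ∃ B ∈ matricesOf (K.comap Subtype.val), A = glue M v b B := by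
  have cross (r : R) (p) : A (Sum.inl r) (Sum.inr p) ≠ 0 ↔ r = v ∧ K.Adj w p :=
    hA.2 _ _ Sum.inl_ne_inr
  have cross_eq_zero (r : R) (p) (hr : r ≠ v) : A (Sum.inl r) (Sum.inr p) = 0 := by
    by_contra h
    exact hr ((cross r p).1 h).1
  refine ⟨A.toBlocks₁₁, submatrix_mem_matricesOf hA ⟨.inl, Iff.rfl⟩,
    fun p => A (Sum.inl v) (Sum.inr p), fun p => by simp [cross], A.toBlocks₂₂,
    submatrix_mem_matricesOf hA ⟨.inr, Iff.rfl⟩, ?_⟩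
  ext (r | p) (s | q)
  · rfl
  · obtain rfl | hr := eq_or_ne r v <;> simp [glue, vecMulVec_apply, *]
  · rw [← hA.1.apply]
    obtain rfl | hs := eq_or_ne s v <;> simp [glue, vecMulVec_apply, *]
  · rfl

theorem ne_zero_of_not_isIsolated {b : {x // x ≠ w} → ℝ} (hb : ∀ p, b p ≠ 0 ↔ K.Adj w p)
    (hK : ¬K.IsIsolated w) : b ≠ 0 := by
  obtain ⟨p, hp⟩ := SimpleGraph.exists_adj_iff_not_isIsolated.2 hK
  exact Function.ne_iff.2 ⟨⟨p, hp.ne'⟩, (hb _).2 hp⟩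

variable [Fintype R] [Fintype W] [DecidableEq W] [Fintype W'] [DecidableEq W']

theorem allowsWithSNIP_vertexSum_of_trivialKernelOn (hK : ¬K.IsIsolated w)
    (hK' : ¬K'.IsIsolated w') {A : Matrix (R ⊕ {x // x ≠ w}) (R ⊕ {x // x ≠ w}) ℝ}
    (hA : A ∈ matricesOf (vertexSum H v K w)) (hS : HasSNIP A (Sum.inl i))
    (hker : TrivialKernelOn A (Set.range Sum.inr)) :
    AllowsWithSNIP (vertexSum H v K' w') (Sum.inl i) (nullity A)
      (nullity (deleteIndex A (Sum.inl i))) := by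
  classical
  obtain ⟨M, hM, b, hb, B, hB, rfl⟩ := exists_eq_glue hA
  have hb0 := ne_zero_of_not_isIsolated hb hK
  obtain ⟨u, c, d, hu⟩ := exists_reducesToPendant hB.1 (trivialKernelOn_range_inr_glue_iff.1 hker)
  let b' : {x // x ≠ w'} → ℝ := fun p => if K'.Adj w' p then 1 else 0
  have hb' (p) : b' p ≠ 0 ↔ K'.Adj w' p := by simp [b']
  have hb'0 := ne_zero_of_not_isIsolated hb' hK'
  obtain ⟨B', hB', u', hu'⟩ :=
    exists_mem_matricesOf_reducesToPendant (K'.comap Subtype.val) hb'0 c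
  have hbu' : b' ⬝ᵥ u' ≠ 0 := by simp [hu'.dotProduct_eq]
  obtain ⟨p, -, hp⟩ := Finset.exists_ne_zero_of_sum_ne_zero hbu'
  have pendant_eq : gluePendant (M + single v v d + single v v 0) v c =
      gluePendant (M + single v v d) v c := by rw [single_zero, add_zero]
  refine ⟨_, glue_mem_matricesOf (add_single_mem_matricesOf hM v d) hb' hB', ?_, ?_,
    hu'.hasSNIP_glue (left_ne_zero_of_mul hp) (right_ne_zero_of_mul hp) ?_⟩
  · rw [hu.nullity_glue hb0, hu'.nullity_glue hb'0, pendant_eq]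
  · rw [hu.nullity_deleteIndex_glue hb0, hu'.nullity_deleteIndex_glue hb'0, pendant_eq]
  · rw [pendant_eq]
    exact hu.hasSNIP_gluePendant hb0 hS

omit [DecidableEq R] in
theorem trivialKernelOn_range_inr_of_subsingleton [Subsingleton {x // x ≠ w}]
    (hK : ¬K.IsIsolated w) {A : Matrix (R ⊕ {x // x ≠ w}) (R ⊕ {x // x ≠ w}) ℝ}
    (hA : A ∈ matricesOf (vertexSum H v K w)) : TrivialKernelOn A (Set.range Sum.inr) := by
  classical
  obtain ⟨M, -, b, hb, B, -, rfl⟩ := exists_eq_glue hA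
  obtain ⟨p, hp⟩ := Function.ne_iff.1 (ne_zero_of_not_isIsolated hb hK)
  refine trivialKernelOn_range_inr_glue_iff.2 fun x _ hbx => funext fun q => ?_
  rw [dotProduct, Fintype.sum_subsingleton _ p] at hbx
  rw [Subsingleton.elim q p]
  exact (mul_eq_zero.1 hbx).resolve_left hp

theorem AllowsWithSNIP.add_le_xixi {V : Type*} [Fintype V] [DecidableEq V] {G : SimpleGraph V}
    {j : V} {k l : ℕ} (h : AllowsWithSNIP G j k l) (hkl : k ≤ l) : k + l ≤ xixi G j :=
  (isGreatest_xixi G j).2 ⟨k, l, hkl, h, rfl⟩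

theorem xixi_le_of_forall_allowsWithSNIP {V : Type*} [Fintype V] [DecidableEq V]
    {G : SimpleGraph V} {j : V} {n : ℕ}
    (h : ∀ k l, k ≤ l → AllowsWithSNIP G j k l → k + l ≤ n) : xixi G j ≤ n := by
  obtain ⟨k, l, hkl, hG, hxixi⟩ := (isGreatest_xixi G j).1
  exact hxixi.trans_le (h k l hkl hG)

theorem xixi_vertexSum_top_le (H : SimpleGraph R) (v i : R) (hK : ¬K.IsIsolated w) :
    xixi (vertexSum H v (⊤ : SimpleGraph (Fin 2)) 0) (Sum.inl i) ≤
      xixi (vertexSum H v K w) (Sum.inl i) := by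
  have : Subsingleton {x : Fin 2 // x ≠ 0} := ⟨by decide⟩
  have htop := (SimpleGraph.connected_top (V := Fin 2)).preconnected.not_isIsolated 0
  refine xixi_le_of_forall_allowsWithSNIP ?_
  rintro _ _ hkl ⟨A, hA, rfl, rfl, hS⟩
  exact (allowsWithSNIP_vertexSum_of_trivialKernelOn htop hK hA hS
    (trivialKernelOn_range_inr_of_subsingleton htop hA)).add_le_xixi hkl

end VertexSum

section Comm

variable {V W₁ W₂ : Type*}

/-- The equivalence exchanging the last two of three summands. -/
def sumRightComm (α β γ : Type*) : (α ⊕ β) ⊕ γ ≃ (α ⊕ γ) ⊕ β :=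
  (Equiv.sumAssoc α β γ).trans
    (((Equiv.refl α).sumCongr (Equiv.sumComm β γ)).trans (Equiv.sumAssoc α γ β).symm)

/-- Two vertex sums with the same graph may be performed in either order. -/
def vertexSumComm (G₀ : SimpleGraph V) (v₁ v₂ : V) (G₁ : SimpleGraph W₁) (w₁ : W₁)
    (G₂ : SimpleGraph W₂) (w₂ : W₂) :
    vertexSum (vertexSum G₀ v₁ G₁ w₁) (Sum.inl v₂) G₂ w₂ ≃g
      vertexSum (vertexSum G₀ v₂ G₂ w₂) (Sum.inl v₁) G₁ w₁ where
  toEquiv := sumRightComm _ _ _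
  map_rel_iff' := by
    rintro ((a | x) | y) ((b | x') | y') <;> simp [vertexSum, sumRightComm]

variable [Fintype V] [DecidableEq V] [Fintype W₁] [DecidableEq W₁] [Fintype W₂] [DecidableEq W₂]

theorem xixi_le_of_iso {G : SimpleGraph W₁} {H : SimpleGraph W₂} (e : H ≃g G) (i : W₂) :
    xixi G (e i) ≤ xixi H i := by
  refine xixi_le_of_forall_allowsWithSNIP ?_
  rintro _ _ hkl ⟨A, hA, rfl, rfl, hS⟩
  exact AllowsWithSNIP.add_le_xixi ⟨A.submatrix e.toEquiv e.toEquiv,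
    submatrix_mem_matricesOf hA e.toEmbedding, nullity_submatrix A e.toEquiv,
    nullity_deleteIndex_submatrix A e.toEquiv i, hS.submatrix e.toEquiv⟩ hkl

theorem xixi_vertexSum_comm (G₀ : SimpleGraph V) (v₁ v₂ i : V) (G₁ : SimpleGraph W₁) (w₁ : W₁)
    (G₂ : SimpleGraph W₂) (w₂ : W₂) :
    xixi (vertexSum (vertexSum G₀ v₁ G₁ w₁) (Sum.inl v₂) G₂ w₂) (Sum.inl (Sum.inl i)) =
      xixi (vertexSum (vertexSum G₀ v₂ G₂ w₂) (Sum.inl v₁) G₁ w₁) (Sum.inl (Sum.inl i)) :=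
  le_antisymm (xixi_le_of_iso (vertexSumComm G₀ v₂ v₁ G₂ w₂ G₁ w₁) (Sum.inl (Sum.inl i)))
    (xixi_le_of_iso (vertexSumComm G₀ v₁ v₂ G₁ w₁ G₂ w₂) (Sum.inl (Sum.inl i)))

theorem trivialKernelOn_or_of_vertexSum {G₀ : SimpleGraph V} {v₁ v₂ : V} {G₁ : SimpleGraph W₁}
    {w₁ : W₁} {G₂ : SimpleGraph W₂} {w₂ : W₂}
    {A : Matrix ((V ⊕ {x // x ≠ w₁}) ⊕ {x // x ≠ w₂}) ((V ⊕ {x // x ≠ w₁}) ⊕ {x // x ≠ w₂}) ℝ}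
    (hA : A ∈ matricesOf (vertexSum (vertexSum G₀ v₁ G₁ w₁) (Sum.inl v₂) G₂ w₂))
    {i : (V ⊕ {x // x ≠ w₁}) ⊕ {x // x ≠ w₂}} (hS : HasSNIP A i) :
    TrivialKernelOn A (Set.range (Sum.inl ∘ Sum.inr)) ∨ TrivialKernelOn A (Set.range Sum.inr) := by
  refine hS.trivialKernelOn_or hA.1 ?_ ?_
  · rw [Set.disjoint_left]
    rintro _ ⟨p, rfl⟩ ⟨q, hq⟩
    exact Sum.inr_ne_inl hq
  · rintro _ ⟨p, rfl⟩ _ ⟨q, rfl⟩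
    by_contra hpq
    exact Sum.inr_ne_inl ((hA.2 _ _ Sum.inl_ne_inr).1 hpq).1

theorem allowsWithSNIP_vertexSum_comm_of_trivialKernelOn {W' : Type*} [Fintype W'] [DecidableEq W']
    {G₀ : SimpleGraph V} {v₁ v₂ i : V} {G₁ : SimpleGraph W₁} {w₁ : W₁} {G₂ : SimpleGraph W₂}
    {w₂ : W₂} {K' : SimpleGraph W'} {w' : W'} (hG₁ : ¬G₁.IsIsolated w₁) (hK' : ¬K'.IsIsolated w')
    {A : Matrix ((V ⊕ {x // x ≠ w₁}) ⊕ {x // x ≠ w₂}) ((V ⊕ {x // x ≠ w₁}) ⊕ {x // x ≠ w₂}) ℝ}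
    (hA : A ∈ matricesOf (vertexSum (vertexSum G₀ v₁ G₁ w₁) (Sum.inl v₂) G₂ w₂))
    (hS : HasSNIP A (Sum.inl (Sum.inl i)))
    (hker : TrivialKernelOn A (Set.range (Sum.inl ∘ Sum.inr))) :
    AllowsWithSNIP (vertexSum (vertexSum G₀ v₂ G₂ w₂) (Sum.inl v₁) K' w') (Sum.inl (Sum.inl i))
      (nullity A) (nullity (deleteIndex A (Sum.inl (Sum.inl i)))) := by
  let e := vertexSumComm G₀ v₂ v₁ G₂ w₂ G₁ w₁
  have hi : e.toEquiv (Sum.inl (Sum.inl i)) = Sum.inl (Sum.inl i) := rfl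
  have hrange : e.toEquiv ⁻¹' Set.range (Sum.inl ∘ Sum.inr) = Set.range Sum.inr := by
    rw [← e.toEquiv.image_symm_eq_preimage, ← Set.range_comp]
    rfl
  have hker' := hker.submatrix e.toEquiv e.toEquiv
  rw [hrange] at hker'
  rw [← hi] at hS ⊢
  rw [← nullity_submatrix A e.toEquiv, ← nullity_deleteIndex_submatrix A e.toEquiv]
  exact allowsWithSNIP_vertexSum_of_trivialKernelOn hG₁ hK'
    (submatrix_mem_matricesOf hA e.toEmbedding) (hS.submatrix e.toEquiv) hker'

end Comm

end RootedGraph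

open RootedGraph in
theorem mainTheorem9_general {V₀ V₁ V₂ : Type*}
    [Fintype V₀] [DecidableEq V₀] [Fintype V₁] [DecidableEq V₁] [Fintype V₂] [DecidableEq V₂]
    (G₀ : SimpleGraph V₀) (G₁ : SimpleGraph V₁) (G₂ : SimpleGraph V₂)
    (v₁ v₂ : V₀) (w₁ : V₁) (w₂ : V₂) (hw₁ : ¬G₁.IsIsolated w₁) (hw₂ : ¬G₂.IsIsolated w₂) (i : V₀) :
    xixi (vertexSum (vertexSum G₀ v₁ G₁ w₁) (Sum.inl v₂) G₂ w₂) (Sum.inl (Sum.inl i)) =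
      max
        (xixi (vertexSum (vertexSum G₀ v₁ (⊤ : SimpleGraph (Fin 2)) 0) (Sum.inl v₂) G₂ w₂)
          (Sum.inl (Sum.inl i)))
        (xixi (vertexSum (vertexSum G₀ v₁ G₁ w₁) (Sum.inl v₂) (⊤ : SimpleGraph (Fin 2)) 0)
          (Sum.inl (Sum.inl i))) := by
  have htop := (SimpleGraph.connected_top (V := Fin 2)).preconnected.not_isIsolated 0
  refine le_antisymm (xixi_le_of_forall_allowsWithSNIP ?_) (max_le ?_ ?_)
  · rintro _ _ hkl ⟨A, hA, rfl, rfl, hS⟩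
    obtain hker | hker := trivialKernelOn_or_of_vertexSum hA hS
    · rw [xixi_vertexSum_comm G₀ v₁ v₂]
      exact le_max_of_le_left ((allowsWithSNIP_vertexSum_comm_of_trivialKernelOn hw₁ htop hA hS
        hker).add_le_xixi hkl)
    · exact le_max_of_le_right ((allowsWithSNIP_vertexSum_of_trivialKernelOn hw₂
        htop hA hS hker).add_le_xixi hkl)
  · rw [xixi_vertexSum_comm, xixi_vertexSum_comm G₀ v₁ v₂ i G₁]
    exact xixi_vertexSum_top_le _ _ _ hw₁
  · exact xixi_vertexSum_top_le _ _ _ hw₂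

theorem mainTheorem9 {V₀ V₁ V₂ : Type*}
    [Fintype V₀] [DecidableEq V₀] [Fintype V₁] [DecidableEq V₁] [Fintype V₂] [DecidableEq V₂]
    (G₀ : SimpleGraph V₀) (G₁ : SimpleGraph V₁) (G₂ : SimpleGraph V₂)
    (v₁ v₂ : V₀) (w₁ : V₁) (w₂ : V₂)
    (hG₁ : G₁.Connected) (hV₁ : 2 ≤ Fintype.card V₁)
    (hG₂ : G₂.Connected) (hV₂ : 2 ≤ Fintype.card V₂)
    (i : V₀) :
    RootedGraph.xixi
        (RootedGraph.vertexSum (RootedGraph.vertexSum G₀ v₁ G₁ w₁) (Sum.inl v₂) G₂ w₂)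
        (Sum.inl (Sum.inl i)) =
      max
        (RootedGraph.xixi
          (RootedGraph.vertexSum
            (RootedGraph.vertexSum G₀ v₁ (⊤ : SimpleGraph (Fin 2)) 0) (Sum.inl v₂) G₂ w₂)
          (Sum.inl (Sum.inl i)))
        (RootedGraph.xixi
          (RootedGraph.vertexSum
            (RootedGraph.vertexSum G₀ v₁ G₁ w₁) (Sum.inl v₂) (⊤ : SimpleGraph (Fin 2)) 0)
          (Sum.inl (Sum.inl i))) := by
  have := Fintype.one_lt_card_iff_nontrivial.1 hV₁
  have := Fintype.one_lt_card_iff_nontrivial.1 hV₂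
  exact mainTheorem9_general G₀ G₁ G₂ v₁ v₂ w₁ w₂ (hG₁.preconnected.not_isIsolated w₁)
    (hG₂.preconnected.not_isIsolated w₂) i
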